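/- Consider the game of Cops and Robbers with $k\ge 1$ cops on a finite simple graph $G$. In round $0$ the cops choose their vertices (several cops may share a vertex), and then the robber, seeing them, chooses a vertex. In each later round every cop stays or moves along an edge, and then the robber stays or moves along an edge. The robber is captured in a round if at some moment of that round a cop and the robber are on the same vertex. A vertex is damaged if, for some $t\ge 0$, the robber occupies it at the end of round $t$ and no capture occurs in any of the rounds $0,1,\dots,t+1$. The $k$-damage number $\operatorname{dmg}_k(G)$ is the least $m$ such that the $k$ cops have a strategy under which, however the robber plays, at most $m$ vertices are damaged. For a graph $G$ with $n\ge 1$ vertices, the damage throttling number is $$\operatorname{th}_d(G)=\min_{1\le k\le n}\bigl(k+\operatorname{dmg}_k(G)\bigr).$$ **Theorem.** There are a constant $c>0$ and an integer $N$ such that for every $n\ge N$ there is a connected graph $X$ with exactly $n$ vertices and $$\operatorname{th}_d(X)\ \ge\ c\,n^{2/3}.$$ -/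

import Mathlib

namespace CopsRobbers

variable {V : Type*}

/-- A step of a player: stay put or move along an edge. -/
def Step (G : SimpleGraph V) (u v : V) : Prop := v = u ∨ G.Adj u v

/-- A strategy of `k` cops on `G`. `pos h` is the placement of the cops when `h` is the list of all
positions taken by the robber so far, the most recent one first. So `pos []` is the initial
placement, chosen before the robber is placed, and `pos [rₜ₋₁, …, r₀]` is the placement after the
cops' move in round `t`. Several cops may share a vertex. -/
structure CopStrategy (G : SimpleGraph V) (k : ℕ) where
  pos : List V → Fin k → V
  legal : ∀ (h : List V) (v : V) (i : Fin k), Step G (pos h i) (pos (v :: h) i)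

/-- A play of the robber: `r t` is the robber's vertex at the end of round `t`
(in round `0` the robber is placed). -/
def IsRobberPlay (G : SimpleGraph V) (r : ℕ → V) : Prop := ∀ t, Step G (r t) (r (t + 1))

/-- The robber's positions in the rounds before round `t`, the most recent one first. -/
def history (r : ℕ → V) : ℕ → List V
  | 0 => []
  | t + 1 => r t :: history r t

/-- Position of cop `i` in round `t` (after the cops' move of that round). -/
def CopStrategy.at {G : SimpleGraph V} {k : ℕ} (σ : CopStrategy G k) (r : ℕ → V) (t : ℕ)
    (i : Fin k) : V := σ.pos (history r t) i

/-- In round `t` a cop and the robber are on the same vertex: after the cops' move (the robber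
is then still on the vertex of the previous round), or after the robber's move. -/
def CaptureIn {G : SimpleGraph V} {k : ℕ} (σ : CopStrategy G k) (r : ℕ → V) : ℕ → Prop
  | 0 => ∃ i, σ.at r 0 i = r 0
  | t + 1 => ∃ i, σ.at r (t + 1) i = r t ∨ σ.at r (t + 1) i = r (t + 1)

/-- The damaged vertices: those which the robber occupies at the end of some round `t` such that
no capture happens up to and including round `t + 1`. What `r` does after a capture is irrelevant. -/
def damaged {G : SimpleGraph V} {k : ℕ} (σ : CopStrategy G k) (r : ℕ → V) : Set V :=
  {v | ∃ t, r t = v ∧ ∀ s ≤ t + 1, ¬ CaptureIn σ r s}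

/-- The `k`-damage number: the least `m` such that `k` cops have a strategy under which at most
`m` vertices are damaged, however the robber plays. -/
noncomputable def dmg [Fintype V] (G : SimpleGraph V) (k : ℕ) : ℕ :=
  sInf {m | ∃ σ : CopStrategy G k, ∀ r, IsRobberPlay G r → (damaged σ r).ncard ≤ m}

/-- The damage throttling number: the minimum of `k + dmg G k` over `1 ≤ k ≤ |V|`. -/
noncomputable def dmgThrottling [Fintype V] (G : SimpleGraph V) : ℕ :=
  sInf ((fun k => k + dmg G k) '' Set.Icc 1 (Fintype.card V))

end CopsRobbers

namespace CopsRobbers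

open Finset

/-! ### Robber plays against a fixed cop strategy -/

section Game

variable {V : Type*} {G : SimpleGraph V} {k : ℕ}

/-! Hang `b` incidence graphs of affine planes of order `q`, `4b < q ≤ 8b`, without vertical lines,
at distance `4b² + 1` along a path; this takes order `b³` vertices. Of fewer than `b²` cops, fewer
than `b` start with feet within `2b²` of some plane, and no other cop can guard that plane for `2b²`
rounds (`comb_exists_damaging_play`).

There the robber reaches a fresh point every second round. Each nearby cop guards at most one line
through the robber's point, and while fewer than `b²` points are damaged, fewer than `b` lines are
over half damaged (`Arena.exists_line`). On the line chosen, at least half the points are fresh and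
fewer than `b` are guarded (`Arena.exists_point`). So `b²` points get damaged. -/

theorem history_congr {r r' : ℕ → V} {t : ℕ} (h : ∀ s < t, r s = r' s) :
    history r t = history r' t := by
  induction t with
  | zero => rfl
  | succ t ih =>
    simp only [history]
    rw [h t (Nat.lt_succ_self t), ih fun s hs => h s (hs.trans (Nat.lt_succ_self t))]

theorem CopStrategy.at_congr (σ : CopStrategy G k) {r r' : ℕ → V} {t : ℕ}
    (h : ∀ s < t, r s = r' s) : σ.at r t = σ.at r' t := by
  funext i
  simp only [CopStrategy.at, history_congr h]

/-- Cops see only the past, so the robber's play can be built round by round. -/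
theorem captureIn_congr (σ : CopStrategy G k) {r r' : ℕ → V} {t : ℕ}
    (h : ∀ s ≤ t, r s = r' s) : CaptureIn σ r t ↔ CaptureIn σ r' t := by
  have hat := σ.at_congr fun s hs => h s (le_of_lt hs)
  cases t with
  | zero => simp only [CaptureIn, hat, h 0 le_rfl]
  | succ t => simp only [CaptureIn, hat, h t (Nat.le_succ t), h (t + 1) le_rfl]

theorem CopStrategy.step_at (σ : CopStrategy G k) (r : ℕ → V) (t : ℕ) (i : Fin k) :
    Step G (σ.at r t i) (σ.at r (t + 1) i) :=
  σ.legal (history r t) (r t) i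

/-- The robber follows `r`, rests from round `t` on, has not been captured up to round `t`, and
cannot be captured by the next move of the cops. -/
structure SafeUntil (σ : CopStrategy G k) (r : ℕ → V) (t : ℕ) : Prop where
  play : IsRobberPlay G r
  rest : ∀ s, t ≤ s → r s = r t
  free : ∀ s ≤ t, ¬ CaptureIn σ r s
  unguarded : ∀ i, ¬ Step G (σ.at r t i) (r t)

theorem SafeUntil.at_succ_ne {σ : CopStrategy G k} {r : ℕ → V} {t : ℕ} (h : SafeUntil σ r t)
    (i : Fin k) : σ.at r (t + 1) i ≠ r t := fun e =>
  h.unguarded i (e ▸ σ.step_at r t i)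

/-- Damage also needs round `s + 1` free of capture; for `s = t` this is what resting on an
unguarded vertex gives. -/
theorem SafeUntil.mem_damaged {σ : CopStrategy G k} {r : ℕ → V} {t s : ℕ} (h : SafeUntil σ r t)
    (hs : s ≤ t) : r s ∈ damaged σ r := by
  refine ⟨s, rfl, fun u hu => ?_⟩
  rcases Nat.lt_or_ge t u with htu | htu
  · obtain rfl : u = t + 1 := by omega
    rintro ⟨i, hi⟩
    rw [h.rest (t + 1) (Nat.le_succ t), or_self] at hi
    exact h.at_succ_ne i hi
  · exact h.free u htu

/-- The robber may safely be placed on any vertex that the cops do not reach at once. -/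
theorem safeUntil_zero (σ : CopStrategy G k) {w : V} (hw : ∀ i, ¬ Step G (σ.pos [] i) w) :
    SafeUntil σ (fun _ => w) 0 where
  play _ := Or.inl rfl
  rest _ _ := rfl
  free s hs := by
    obtain rfl : s = 0 := by omega
    rintro ⟨i, hi⟩
    exact hw i (Or.inl hi.symm)
  unguarded := hw

/-- A safe play extends by a move to any neighbour that the cops do not guard after their move. -/
theorem SafeUntil.extend {σ : CopStrategy G k} {r : ℕ → V} {t : ℕ} (h : SafeUntil σ r t) {w : V}
    (hadj : G.Adj (r t) w) (hw : ∀ i, ¬ Step G (σ.at r (t + 1) i) w) :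
    ∃ r', SafeUntil σ r' (t + 1) ∧ (∀ s ≤ t, r' s = r s) ∧ r' (t + 1) = w := by
  classical
  let r' : ℕ → V := fun s => if s ≤ t then r s else w
  have hold : ∀ s ≤ t, r' s = r s := fun s hs => if_pos hs
  have hnew : ∀ s, t < s → r' s = w := fun s hs => if_neg (not_le.2 hs)
  have hat : σ.at r' (t + 1) = σ.at r (t + 1) :=
    σ.at_congr fun s hs => hold s (Nat.lt_succ_iff.1 hs)
  refine ⟨r', ⟨fun s => ?_, fun s hs => ?_, fun s hs => ?_, fun i => ?_⟩, hold,
    hnew _ (Nat.lt_succ_self t)⟩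
  · rcases lt_trichotomy s t with hst | rfl | hst
    · rw [hold s hst.le, hold (s + 1) hst]
      exact h.play s
    · rw [hold s le_rfl, hnew (s + 1) (Nat.lt_succ_self s)]
      exact Or.inr hadj
    · rw [hnew s hst, hnew (s + 1) (hst.trans (Nat.lt_succ_self s))]
      exact Or.inl rfl
  · rw [hnew s hs, hnew (t + 1) (Nat.lt_succ_self t)]
  · rcases Nat.lt_or_ge t s with hts | hts
    · obtain rfl : s = t + 1 := by omega
      rintro ⟨i, hi⟩
      rw [hat, hold t le_rfl, hnew (t + 1) (Nat.lt_succ_self t)] at hi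
      rcases hi with hi | hi
      · exact h.at_succ_ne i hi
      · exact hw i (Or.inl hi.symm)
    · rw [captureIn_congr σ fun u hu => hold u (hu.trans hts)]
      exact h.free s hts
  · rw [hat, hnew (t + 1) (Nat.lt_succ_self t)]
    exact hw i

/-- Transport of a strategy along a graph isomorphism. -/
def CopStrategy.map {W : Type*} {H : SimpleGraph W} (σ : CopStrategy G k) (e : G ≃g H) :
    CopStrategy H k where
  pos h i := e (σ.pos (h.map e.symm) i)
  legal h v i := by
    rcases σ.legal (h.map e.symm) (e.symm v) i with h' | h'
    · exact Or.inl (congrArg e h')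
    · exact Or.inr (e.map_adj_iff.2 h')

theorem history_map {W : Type*} (f : V → W) (r : ℕ → V) (t : ℕ) :
    history (f ∘ r) t = (history r t).map f := by
  induction t with
  | zero => rfl
  | succ t ih => simp [history, ih]

theorem captureIn_map {W : Type*} {H : SimpleGraph W} (σ : CopStrategy G k) (e : G ≃g H)
    (r : ℕ → W) (t : ℕ) : CaptureIn (σ.map e) r t ↔ CaptureIn σ (e.symm ∘ r) t := by
  have hat : ∀ s i w, (σ.map e).at r s i = w ↔ σ.at (e.symm ∘ r) s i = e.symm w := by
    intro s i w
    simp only [CopStrategy.at, CopStrategy.map, history_map]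
    exact e.toEquiv.eq_symm_apply.symm
  cases t <;> simp only [CaptureIn, hat, Function.comp_apply]

theorem damaged_map {W : Type*} {H : SimpleGraph W} (σ : CopStrategy G k) (e : G ≃g H)
    (r : ℕ → W) : damaged σ (e.symm ∘ r) = e.symm '' damaged (σ.map e) r := by
  ext v
  simp only [damaged, captureIn_map, Set.mem_ofPred_eq, Set.mem_image, Function.comp_apply]
  constructor
  · rintro ⟨t, rfl, ht⟩
    exact ⟨r t, ⟨t, rfl, ht⟩, rfl⟩
  · rintro ⟨_, ⟨t, rfl, ht⟩, rfl⟩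
    exact ⟨t, rfl, ht⟩

theorem le_dmgThrottling [Fintype V] [Nonempty V] {m : ℕ}
    (h : ∀ k < m, ∀ σ : CopStrategy G k, ∃ r, IsRobberPlay G r ∧ m ≤ (damaged σ r).ncard) :
    m ≤ dmgThrottling G := by
  refine le_csInf ((Set.nonempty_Icc.2 Fintype.card_pos).image _) ?_
  rintro _ ⟨k, -, rfl⟩
  rcases Nat.lt_or_ge k m with hk | hk
  · refine le_trans (le_csInf ?_ ?_) (Nat.le_add_left _ _)
    -- `sInf ∅ = 0`, so some bound must be attained: motionless cops and the bound `|V|` will do.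
    · obtain ⟨v⟩ := ‹Nonempty V›
      refine ⟨Fintype.card V, ⟨fun _ _ => v, fun _ _ _ => Or.inl rfl⟩, fun r _ => ?_⟩
      rw [← Nat.card_eq_fintype_card]
      exact Set.ncard_le_card _
    · rintro d ⟨σ, hσ⟩
      obtain ⟨r, hr, hm⟩ := h k hk σ
      exact hm.trans (hσ r hr)
  · exact hk.trans (Nat.le_add_right _ _)

theorem exists_damaging_play_of_iso {W : Type*} {H : SimpleGraph W} (e : G ≃g H) {m : ℕ}
    (h : ∀ σ : CopStrategy H k, ∃ r, IsRobberPlay H r ∧ m ≤ (damaged σ r).ncard)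
    (σ : CopStrategy G k) : ∃ r, IsRobberPlay G r ∧ m ≤ (damaged σ r).ncard := by
  obtain ⟨r, hr, hm⟩ := h (σ.map e)
  refine ⟨e.symm ∘ r, fun t => ?_, ?_⟩
  · rcases hr t with ht | ht
    · exact Or.inl (congrArg e.symm ht)
    · exact Or.inr (e.symm.map_adj_iff.2 ht)
  · rwa [damaged_map, Set.ncard_image_of_injective _ e.symm.injective]

end Game

/-! ### The robber's escape in a partial linear space -/

section LinearSpace

/-- A finite partial linear space in which every point lies on `q` lines and every line contains
`q` points. -/
structure PartialLinearSpace (P L : Type*) (q : ℕ) where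
  pts : L → Finset P
  lns : P → Finset L
  mem_lns : ∀ {p l}, l ∈ lns p ↔ p ∈ pts l
  card_pts : ∀ l, #(pts l) = q
  card_lns : ∀ p, #(lns p) = q
  eq_or_eq : ∀ {p p' l l'}, p ∈ pts l → p ∈ pts l' → p' ∈ pts l → p' ∈ pts l' → p = p' ∨ l = l'

variable {P L : Type*} [DecidableEq P] {q b : ℕ}

/-- Lines that are more than half full share few points, so together they contain many points. -/
theorem PartialLinearSpace.card_mul_le (S : PartialLinearSpace P L q) (D : Finset P)
    (B : Finset L) (hB : ∀ l ∈ B, q < 2 * #(D ∩ S.pts l)) :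
    #B * q ≤ 2 * #(B.biUnion fun l => D ∩ S.pts l) + 2 * #B ^ 2 := by
  classical
  induction B using Finset.induction_on with
  | empty => simp
  | insert l B hl ih =>
    have ih := ih fun l' hl' => hB l' (mem_insert_of_mem hl')
    have hq := hB l (mem_insert_self l B)
    have hinter : #((D ∩ S.pts l) ∩ B.biUnion fun l => D ∩ S.pts l) ≤ #B := by
      rw [inter_biUnion]
      refine (card_biUnion_le_card_mul _ _ 1 fun l' hl' => ?_).trans_eq (mul_one _)
      refine card_le_one.2 fun p hp p' hp' => ?_
      simp only [mem_inter] at hp hp'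
      refine (S.eq_or_eq hp.1.2 hp.2.2 hp'.1.2 hp'.2.2).resolve_right ?_
      rintro rfl
      exact hl hl'
    have hunion := card_union_add_card_inter (D ∩ S.pts l) (B.biUnion fun l => D ∩ S.pts l)
    rw [biUnion_insert, card_insert_of_notMem hl]
    -- The new line meets each earlier one in at most one point, so it adds more than `q/2 - #B`
    -- points.
    nlinarith

theorem PartialLinearSpace.card_lt_of_half_full (S : PartialLinearSpace P L q) (hq : 4 * b ≤ q)
    {D : Finset P} (hD : #D < b ^ 2) (B : Finset L) (hB : ∀ l ∈ B, q < 2 * #(D ∩ S.pts l)) :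
    #B < b := by
  by_contra! hb
  obtain ⟨B', hB', rfl⟩ := exists_subset_card_eq hb
  have h := S.card_mul_le D B' fun l hl => hB l (hB' hl)
  have hsub : #(B'.biUnion fun l => D ∩ S.pts l) ≤ #D :=
    card_le_card (biUnion_subset.2 fun l _ => inter_subset_left)
  -- For exactly `b` lines, `bq ≤ 2 * #D + 2b² < 4b² ≤ bq`.
  nlinarith

theorem card_filter_exists_le {α ι : Type*} [DecidableEq α] (s : Finset α) (A : Finset ι)
    (R : ι → α → Prop) [∀ i, DecidablePred (R i)] [DecidablePred fun x => ∃ i ∈ A, R i x]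
    (h : ∀ i ∈ A, ∀ x ∈ s, ∀ y ∈ s, R i x → R i y → x = y) :
    #{x ∈ s | ∃ i ∈ A, R i x} ≤ #A := by
  have hsub : {x ∈ s | ∃ i ∈ A, R i x} ⊆ A.biUnion fun i => {x ∈ s | R i x} := by
    intro x hx
    simp only [mem_filter, mem_biUnion] at hx ⊢
    obtain ⟨hx, i, hi, hR⟩ := hx
    exact ⟨i, hi, hx, hR⟩
  refine (card_le_card hsub).trans
    ((card_biUnion_le_card_mul _ _ 1 fun i hi => card_le_one.2 fun x hx y hy => ?_).trans_eq
      (mul_one _))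
  rw [mem_filter] at hx hy
  exact h i hi x hx.1 y hy.1 hx.2 hy.2

/-- An embedded incidence graph of a partial linear space in which no vertex guards two of the
lines through another point, or two of the points on another line. -/
structure Arena {V : Type*} (G : SimpleGraph V) (S : PartialLinearSpace P L q) where
  pt : P → V
  ln : L → V
  pt_injective : Function.Injective pt
  ln_injective : Function.Injective ln
  adj : ∀ {p l}, p ∈ S.pts l → G.Adj (pt p) (ln l)
  eq_of_guard_lns : ∀ {c p l l'}, c ≠ pt p → p ∈ S.pts l → p ∈ S.pts l' → Step G c (ln l) →
    Step G c (ln l') → l = l'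
  eq_of_guard_pts : ∀ {c l p p'}, c ≠ ln l → p ∈ S.pts l → p' ∈ S.pts l → Step G c (pt p) →
    Step G c (pt p') → p = p'

variable {V : Type*} {G : SimpleGraph V} {S : PartialLinearSpace P L q} {k : ℕ}

theorem Arena.exists_line (X : Arena G S) (hq : 4 * b ≤ q) {D : Finset P} (hD : #D < b ^ 2)
    {c : Fin k → V} {A : Finset (Fin k)} (hA : #A < b)
    (hfar : ∀ i ∉ A, ∀ l, ¬ Step G (c i) (X.ln l)) {p : P} (hp : ∀ i, c i ≠ X.pt p) :
    ∃ l, p ∈ S.pts l ∧ 2 * #(D ∩ S.pts l) ≤ q ∧ ∀ i, ¬ Step G (c i) (X.ln l) := by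
  classical
  have h₁ := S.card_lt_of_half_full hq hD {l ∈ S.lns p | q < 2 * #(D ∩ S.pts l)}
    fun l hl => (mem_filter.1 hl).2
  have h₂ := card_filter_exists_le (S.lns p) A (fun i l => Step G (c i) (X.ln l))
    fun i _ l hl l' hl' => X.eq_of_guard_lns (hp i) (S.mem_lns.1 hl) (S.mem_lns.1 hl')
  obtain ⟨l, hl, hl'⟩ := exists_mem_notMem_of_card_lt_card (t := S.lns p)
      (s := {l ∈ S.lns p | q < 2 * #(D ∩ S.pts l)} ∪
        {l ∈ S.lns p | ∃ i ∈ A, Step G (c i) (X.ln l)}) (by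
    have := card_union_le {l ∈ S.lns p | q < 2 * #(D ∩ S.pts l)}
      {l ∈ S.lns p | ∃ i ∈ A, Step G (c i) (X.ln l)}
    rw [S.card_lns]
    omega)
  simp only [mem_union, mem_filter, hl, true_and, not_or, not_lt, not_exists, not_and] at hl'
  exact ⟨l, S.mem_lns.1 hl, hl'.1, fun i => if hi : i ∈ A then hl'.2 i hi else hfar i hi l⟩

theorem Arena.exists_point (X : Arena G S) (hq : 4 * b ≤ q) {D : Finset P}
    {c : Fin k → V} {A : Finset (Fin k)} (hA : #A < b)
    (hfar : ∀ i ∉ A, ∀ p, ¬ Step G (c i) (X.pt p)) {l : L} (hl : ∀ i, c i ≠ X.ln l)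
    (hD : 2 * #(D ∩ S.pts l) ≤ q) :
    ∃ p ∈ S.pts l, p ∉ D ∧ ∀ i, ¬ Step G (c i) (X.pt p) := by
  classical
  have h₂ := card_filter_exists_le (S.pts l) A (fun i p => Step G (c i) (X.pt p))
    fun i _ p hp p' hp' => X.eq_of_guard_pts (hl i) hp hp'
  obtain ⟨p, hp, hp'⟩ := exists_mem_notMem_of_card_lt_card (s := (D ∩ S.pts l) ∪
      {p ∈ S.pts l | ∃ i ∈ A, Step G (c i) (X.pt p)}) (t := S.pts l) (by
    have := card_union_le (D ∩ S.pts l) {p ∈ S.pts l | ∃ i ∈ A, Step G (c i) (X.pt p)}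
    rw [S.card_pts]
    omega)
  simp only [mem_union, mem_inter, mem_filter, hp, true_and, and_true, not_or, not_exists,
    not_and] at hp'
  exact ⟨p, hp, hp'.1, fun i => if hi : i ∈ A then hp'.2 i hi else hfar i hi p⟩

/-- If fewer than `b` cops come near the arena in the first `2 * b ^ 2` rounds, then the robber
visits a new point of the arena every other round. -/
theorem Arena.exists_safe_play (X : Arena G S) (hq : 4 * b ≤ q) (σ : CopStrategy G k)
    {A : Finset (Fin k)} (hA : #A < b) (hcard : ∃ l : L, ∀ i, σ.pos [] i ≠ X.ln l)
    (hpt : ∀ r t, t ≤ 2 * b ^ 2 → ∀ i ∉ A, ∀ p, ¬ Step G (σ.at r t i) (X.pt p))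
    (hln : ∀ r t, t ≤ 2 * b ^ 2 → ∀ i ∉ A, ∀ l, ¬ Step G (σ.at r t i) (X.ln l))
    (j : ℕ) (hj : j < b ^ 2) :
    ∃ r, SafeUntil σ r (2 * j) ∧ (∃ p, r (2 * j) = X.pt p) ∧
      ∃ D : Finset P, #D = j + 1 ∧ ∀ p ∈ D, ∃ t ≤ 2 * j, r t = X.pt p := by
  induction j with
  | zero =>
    obtain ⟨l, hl⟩ := hcard
    obtain ⟨p, -, -, hp⟩ := X.exists_point hq (D := ∅) hA (hpt (fun _ => X.ln l) 0 (Nat.zero_le _))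
      hl (by simp)
    -- The starting point is taken on a cop-free line; in round `0` the history is empty, so the
    -- play fed to `hpt` is a dummy.
    exact ⟨_, safeUntil_zero σ hp, ⟨p, rfl⟩, {p}, by simp, by simp⟩
  | succ j ih =>
    obtain ⟨r, hr, ⟨p, hp⟩, D, hD, hDr⟩ := ih (by omega)
    obtain ⟨l, hpl, hDl, hl⟩ := X.exists_line hq (D := D) (by omega) hA
      (hln r (2 * j + 1) (by omega)) (fun i => hp ▸ hr.at_succ_ne i)
    obtain ⟨r₁, hr₁, hrr₁, hl₁⟩ := hr.extend (hp ▸ X.adj hpl) hl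
    obtain ⟨p', hp'l, hp'D, hp'⟩ := X.exists_point hq (D := D) hA
      (hpt r₁ (2 * j + 1 + 1) (by omega)) (fun i => hl₁ ▸ hr₁.at_succ_ne i) hDl
    obtain ⟨r₂, hr₂, hrr₂, hp₂⟩ := hr₁.extend (hl₁ ▸ (X.adj hp'l).symm) hp'
    refine ⟨r₂, hr₂, ⟨p', hp₂⟩, insert p' D, by rw [card_insert_of_notMem hp'D, hD], ?_⟩
    intro x hx
    rcases mem_insert.1 hx with rfl | hx
    · exact ⟨_, le_rfl, hp₂⟩
    · obtain ⟨t, ht, htx⟩ := hDr x hx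
      exact ⟨t, by omega, by rw [hrr₂ t (by omega), hrr₁ t ht, htx]⟩

theorem Arena.exists_damaging_play (X : Arena G S) (hq : 4 * b ≤ q) (σ : CopStrategy G k)
    [Finite V] {A : Finset (Fin k)} (hA : #A < b) (hcard : ∃ l : L, ∀ i, σ.pos [] i ≠ X.ln l)
    (hpt : ∀ r t, t ≤ 2 * b ^ 2 → ∀ i ∉ A, ∀ p, ¬ Step G (σ.at r t i) (X.pt p))
    (hln : ∀ r t, t ≤ 2 * b ^ 2 → ∀ i ∉ A, ∀ l, ¬ Step G (σ.at r t i) (X.ln l)) :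
    ∃ r, IsRobberPlay G r ∧ b ^ 2 ≤ (damaged σ r).ncard := by
  have hb : 0 < b ^ 2 := pow_pos (by omega) 2
  obtain ⟨r, hr, -, D, hD, hDr⟩ := X.exists_safe_play hq σ hA hcard hpt hln (b ^ 2 - 1) (by omega)
  refine ⟨r, hr.play, ?_⟩
  have hsub : X.pt '' (D : Set P) ⊆ damaged σ r := by
    rintro _ ⟨p, hp, rfl⟩
    obtain ⟨t, ht, htp⟩ := hDr p hp
    exact htp ▸ hr.mem_damaged ht
  have := Set.ncard_le_ncard hsub (Set.toFinite _)
  rw [Set.ncard_image_of_injective _ X.pt_injective, Set.ncard_coe_finset] at this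
  omega

end LinearSpace

/-! ### The affine plane without vertical lines -/

section AffinePlane

/-- The points `(x, y)` of the affine plane over a field with the lines `y = m * x + a`, written
`(m, a)`. -/
def affinePlane (F : Type*) [Field F] [Fintype F] [DecidableEq F] :
    PartialLinearSpace (F × F) (F × F) (Fintype.card F) where
  pts l := univ.image fun x => (x, l.1 * x + l.2)
  lns p := univ.image fun m => (m, p.2 - m * p.1)
  mem_lns {p l} := by
    obtain ⟨x, y⟩ := p
    obtain ⟨m, a⟩ := l
    simp only [mem_image, mem_univ, true_and, Prod.mk.injEq, exists_eq_left]
    constructor <;> rintro rfl <;> ring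
  card_pts l := by
    rw [card_image_of_injective _ fun x y h => (Prod.mk.inj h).1, card_univ]
  card_lns p := by
    rw [card_image_of_injective _ fun x y h => (Prod.mk.inj h).1, card_univ]
  eq_or_eq {p p' l l'} h₁ h₂ h₃ h₄ := by
    obtain ⟨x, y⟩ := p
    obtain ⟨x', y'⟩ := p'
    obtain ⟨m, a⟩ := l
    obtain ⟨m', a'⟩ := l'
    simp only [mem_image, mem_univ, true_and, Prod.mk.injEq, exists_eq_left] at *
    have h : (m - m') * (x - x') = 0 := by linear_combination h₁ - h₂ - h₃ + h₄
    rcases mul_eq_zero.1 h with h | h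
    · obtain rfl := sub_eq_zero.1 h
      exact Or.inr ⟨rfl, by linear_combination h₁ - h₂⟩
    · obtain rfl := sub_eq_zero.1 h
      exact Or.inl ⟨rfl, by linear_combination h₃ - h₁⟩

theorem mem_affinePlane_pts {F : Type*} [Field F] [Fintype F] [DecidableEq F] {p l : F × F} :
    p ∈ (affinePlane F).pts l ↔ p.2 = l.1 * p.1 + l.2 := by
  obtain ⟨x, y⟩ := p
  simp [affinePlane, eq_comm]

end AffinePlane

/-! ### Planes hung along a path -/

section Comb

variable (F : Type*) [Field F] [Fintype F] [DecidableEq F] (b d R : ℕ)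

/-- The vertices of the comb: `b` copies of the points and the lines of the affine plane, and a
path with `R` vertices. -/
abbrev CombVertex := (Fin b × ((F × F) ⊕ (F × F))) ⊕ Fin R

variable {F b R}

/-- Adjacency in the comb: the origin of the `i`-th plane is joined to the vertex `i * d` of the
path. -/
def CombAdj : CombVertex F b R → CombVertex F b R → Prop
  | .inl (i, .inl p), .inl (j, .inr l) => i = j ∧ p ∈ (affinePlane F).pts l
  | .inl (i, .inr l), .inl (j, .inl p) => i = j ∧ p ∈ (affinePlane F).pts l
  | .inl (i, .inl p), .inr a => p = 0 ∧ (a : ℕ) = i * d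
  | .inr a, .inl (i, .inl p) => p = 0 ∧ (a : ℕ) = i * d
  | .inr a, .inr a' => (a : ℕ) + 1 = a' ∨ (a' : ℕ) + 1 = a
  | _, _ => False

/-- The incidence graphs of `b` affine planes, hung on a path at distance `d` from each other. -/
def comb : SimpleGraph (CombVertex F b R) where
  Adj := CombAdj d
  symm := ⟨by
    rintro (⟨i, p | l⟩ | a) (⟨j, p' | l'⟩ | a') h <;> simp only [CombAdj] at h ⊢
    · exact ⟨h.1.symm, h.2⟩
    · exact h
    · exact ⟨h.1.symm, h.2⟩
    · exact h
    · exact h.symm⟩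
  loopless := ⟨by rintro (⟨i, p | l⟩ | a) h <;> simp [CombAdj] at h⟩

/-- The foot of a vertex of the comb on the path. -/
def foot : CombVertex F b R → ℤ
  | .inl (i, _) => i * d
  | .inr a => (a : ℕ)

/-- Projection to the path is 1-Lipschitz, which limits how fast cops approach a plane. -/
theorem abs_foot_sub_le {u v : CombVertex F b R} (h : Step (comb d) u v) :
    |foot d u - foot d v| ≤ 1 := by
  rcases h with rfl | h
  · simp
  · obtain ⟨i, p | l⟩ | a := u <;> obtain ⟨j, p' | l'⟩ | a' := v <;>
      simp only [comb, CombAdj, foot] at h ⊢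
    · simp [h.1]
    · rw [h.2]; simp
    · simp [h.1]
    · rw [h.2]; simp
    · rw [abs_le]; omega

theorem foot_eq_of_step {u : CombVertex F b R} {i : Fin b} {x : (F × F) ⊕ (F × F)}
    (h : Step (comb d) u (.inl (i, x))) : foot d u = i * d := by
  rcases h with h | h
  · rw [← h]; rfl
  · obtain ⟨j, p | l⟩ | a := u <;> obtain p' | l' := x <;>
      simp only [comb, CombAdj, foot] at h ⊢
    · rw [h.1]
    · rw [h.1]
    · rw [h.2]; simp

/-- The `i`-th affine plane of the comb. -/
def combArena (i : Fin b) : Arena (comb d : SimpleGraph (CombVertex F b R)) (affinePlane F) where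
  pt p := .inl (i, .inl p)
  ln l := .inl (i, .inr l)
  pt_injective p p' h := by simpa using h
  ln_injective p p' h := by simpa using h
  adj h := ⟨rfl, h⟩
  eq_of_guard_lns {c p l l'} hc hl hl' h h' := by
    -- A cop on another point shares at most one line with `p`, a cop on a line guards only that
    -- line, and path vertices guard no line.
    obtain ⟨j, p₁ | l₁⟩ | a := c <;> simp [Step, comb, CombAdj] at h h' hc
    · refine ((affinePlane F).eq_or_eq h.2 h'.2 hl hl').resolve_left ?_
      exact hc h.1
    · rw [h.2, h'.2]
  eq_of_guard_pts {c l p p'} hc hp hp' h h' := by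
    obtain ⟨j, p₁ | l₁⟩ | a := c <;> simp [Step, comb, CombAdj] at h h' hc
    · rw [h.2, h'.2]
    · refine ((affinePlane F).eq_or_eq h.2 hp h'.2 hp').resolve_right ?_
      exact hc h.1
    · rw [h.1, h'.1]

theorem comb_connected (hR : ∀ i : Fin b, (i : ℕ) * d < R) (hR₀ : 0 < R) :
    (comb d : SimpleGraph (CombVertex F b R)).Connected := by
  set G := (comb d : SimpleGraph (CombVertex F b R))
  let root : CombVertex F b R := .inr ⟨0, hR₀⟩
  have hpath : ∀ a (ha : a < R), G.Reachable root (.inr ⟨a, ha⟩) := by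
    intro a
    induction a with
    | zero => exact fun _ => .rfl
    | succ a ih =>
      intro ha
      exact (ih (by omega)).trans (SimpleGraph.Adj.reachable (Or.inl rfl))
  have horigin (i : Fin b) : G.Reachable root (.inl (i, .inl 0)) :=
    (hpath _ (hR i)).trans (SimpleGraph.Adj.reachable ⟨rfl, rfl⟩)
  have hinc (i : Fin b) (p l : F × F) (h : p.2 = l.1 * p.1 + l.2) :
      G.Adj (.inl (i, .inl p)) (.inl (i, .inr l)) := ⟨rfl, mem_affinePlane_pts.2 h⟩
  -- Without vertical lines, points with `x = 0` share no line with the origin; they are reached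
  -- later through a horizontal line.
  have hpoint (i : Fin b) (x y : F) (hx : x ≠ 0) : G.Reachable root (.inl (i, .inl (x, y))) :=
    ((horigin i).trans (hinc i 0 (y / x, 0) (by simp)).reachable).trans
      (hinc i (x, y) (y / x, 0) (by simp [hx])).symm.reachable
  have hline (i : Fin b) (l : F × F) : G.Reachable root (.inl (i, .inr l)) :=
    (hpoint i 1 (l.1 * 1 + l.2) one_ne_zero).trans (hinc i _ l rfl).reachable
  refine SimpleGraph.connected_iff_exists_forall_reachable _ |>.2 ⟨root, ?_⟩
  rintro (⟨i, ⟨x, y⟩ | l⟩ | ⟨a, ha⟩)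
  · exact (hline i (0, y)).trans (hinc i (x, y) (0, y) (by simp)).symm.reachable
  · exact hline i l
  · exact hpath a ha

theorem abs_foot_at_le {k : ℕ} (σ : CopStrategy (comb d : SimpleGraph (CombVertex F b R)) k)
    (r : ℕ → CombVertex F b R) (t : ℕ) (i : Fin k) :
    |foot d (σ.pos [] i) - foot d (σ.at r t i)| ≤ t := by
  induction t with
  | zero => simp [CopStrategy.at, history]
  | succ t ih =>
    have := abs_foot_sub_le d (σ.step_at r t i)
    rw [abs_le] at *
    push_cast
    omega

theorem comb_exists_damaging_play (hd : d = 4 * b ^ 2 + 1) (hq : 4 * b ≤ Fintype.card F)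
    {k : ℕ} (hk : k < b ^ 2) (σ : CopStrategy (comb d : SimpleGraph (CombVertex F b R)) k) :
    ∃ r, IsRobberPlay (comb d) r ∧ b ^ 2 ≤ (damaged σ r).ncard := by
  classical
  obtain ⟨j, hj⟩ : ∃ j : Fin b,
      #{i : Fin k | |foot d (σ.pos [] i) - (j : ℤ) * d| ≤ 2 * b ^ 2} < b := by
    by_contra! h
    have hdisj : #((univ : Finset (Fin b)).biUnion fun j =>
        {i : Fin k | |foot d (σ.pos [] i) - (j : ℤ) * d| ≤ 2 * b ^ 2}) =
        ∑ j : Fin b, #{i : Fin k | |foot d (σ.pos [] i) - (j : ℤ) * d| ≤ 2 * b ^ 2} := by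
      refine card_biUnion fun j _ j' _ hjj' => disjoint_left.2 fun i hi hi' => hjj' ?_
      simp only [mem_filter, mem_univ, true_and, abs_le] at hi hi'
      have hd' : (d : ℤ) = 4 * b ^ 2 + 1 := by simp [hd]
      -- Windows of radius `2b²` are disjoint because `d > 4b²`.
      have h₁ : ((j : ℤ) - j') * d < 1 * d := by rw [sub_mul]; linarith
      have h₂ : ((j' : ℤ) - j) * d < 1 * d := by rw [sub_mul]; linarith
      have hd₀ : (0 : ℤ) ≤ d := by positivity
      have h₁ := lt_of_mul_lt_mul_right h₁ hd₀
      have h₂ := lt_of_mul_lt_mul_right h₂ hd₀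
      ext
      omega
    have hle := card_le_univ ((univ : Finset (Fin b)).biUnion fun j =>
        {i : Fin k | |foot d (σ.pos [] i) - (j : ℤ) * d| ≤ 2 * b ^ 2})
    have hge := card_nsmul_le_sum (univ : Finset (Fin b)) _ b fun j _ => h j
    rw [hdisj, Fintype.card_fin] at hle
    rw [card_univ, Fintype.card_fin, smul_eq_mul] at hge
    nlinarith
  have hfar : ∀ r t, t ≤ 2 * b ^ 2 →
      ∀ i ∉ ({i : Fin k | |foot d (σ.pos [] i) - (j : ℤ) * d| ≤ 2 * b ^ 2} : Finset (Fin k)),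
      ∀ x, ¬ Step (comb d) (σ.at r t i) (.inl (j, x)) := by
    intro r t ht i hi x hx
    refine hi (mem_filter.2 ⟨mem_univ i, ?_⟩)
    rw [← foot_eq_of_step d hx]
    exact (abs_foot_at_le d σ r t i).trans (by exact_mod_cast ht)
  refine (combArena d j).exists_damaging_play hq σ hj ?_
    (fun r t ht i hi p => hfar r t ht i hi _) (fun r t ht i hi l => hfar r t ht i hi _)
  -- Otherwise the cops occupy all `q²` lines, yet `k < b² < q²`.
  by_contra! h
  choose f hf using h
  have hcard := Fintype.card_le_of_injective f fun l l' hll' =>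
    (combArena d j).ln_injective ((hf l).symm.trans ((congrArg _ hll').trans (hf l')))
  rw [Fintype.card_prod, Fintype.card_fin] at hcard
  nlinarith

end Comb

/-! ### Choice of parameters -/

/-- A connected graph on `n` vertices with damage throttling number at least `b ^ 2`, where `n` is
any number of order at least `b ^ 3`. -/
theorem exists_connected_sq_le_dmgThrottling {b n : ℕ} (hb : 0 < b) (hn : 133 * b ^ 3 ≤ n) :
    ∃ X : SimpleGraph (Fin n), X.Connected ∧ b ^ 2 ≤ dmgThrottling X := by
  -- With `q ≤ 8b` the planes use at most `128b³` vertices and the path needs at most `5b³`, whence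
  -- `133`; surplus vertices lengthen the path.
  obtain ⟨q, hqp, hq, hq'⟩ := Nat.exists_prime_lt_and_le_two_mul (4 * b) (by omega)
  have : Fact q.Prime := ⟨hqp⟩
  have hplanes : b * (q * q + q * q) ≤ 128 * b ^ 3 := by
    have : q * q ≤ (2 * (4 * b)) * (2 * (4 * b)) := Nat.mul_le_mul hq' hq'
    nlinarith
  have hcube : b * (4 * b ^ 2 + 1) ≤ 5 * b ^ 3 := by
    have : b * 1 ≤ b * b ^ 2 := Nat.mul_le_mul_left b (Nat.one_le_pow 2 b hb)
    nlinarith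
  have hR : b * (4 * b ^ 2 + 1) ≤ n - b * (q * q + q * q) := by omega
  have hcard : Fintype.card (CombVertex (ZMod q) b (n - b * (q * q + q * q))) = n := by
    simp only [Fintype.card_sum, Fintype.card_prod, Fintype.card_fin, ZMod.card]
    omega
  let e := (Fintype.equivFinOfCardEq hcard).symm
  let H : SimpleGraph (CombVertex (ZMod q) b (n - b * (q * q + q * q))) := comb (4 * b ^ 2 + 1)
  let φ : H.comap e ≃g H := SimpleGraph.Iso.comap e H
  have hH : H.Connected := comb_connected _
    (fun i => lt_of_lt_of_le (Nat.mul_lt_mul_of_pos_right i.2 (Nat.succ_pos _)) hR)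
    (lt_of_lt_of_le (Nat.mul_pos hb (Nat.succ_pos _)) hR)
  have hX : (H.comap e).Connected := φ.connected_iff.2 hH
  have := hX.nonempty
  exact ⟨H.comap e, hX, le_dmgThrottling fun k hk =>
    exists_damaging_play_of_iso φ (comb_exists_damaging_play _ rfl (by rw [ZMod.card]; omega) hk)⟩

end CopsRobbers

theorem mainTheorem2 :
    ∃ c : ℝ, 0 < c ∧ ∃ N : ℕ, ∀ n : ℕ, N ≤ n →
      ∃ X : SimpleGraph (Fin n), X.Connected ∧
        c * (n : ℝ) ^ ((2 : ℝ) / 3) ≤ (CopsRobbers.dmgThrottling X : ℝ) := by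
  -- `1064 = 133 * 2³`, from `b + 1 ≤ 2b`.
  refine ⟨1 / 1064, by norm_num, 133, fun n hn => ?_⟩
  let b := Nat.findGreatest (fun b => 133 * b ^ 3 ≤ n) n
  have hb₁ : 1 ≤ b := Nat.le_findGreatest (by omega) (by omega)
  have hbn : 133 * b ^ 3 ≤ n :=
    Nat.findGreatest_spec (P := fun b => 133 * b ^ 3 ≤ n) (m := 1) (by omega) (by omega)
  have hnb : n < 133 * (b + 1) ^ 3 := by
    by_contra! h
    have hle : b + 1 ≤ n := by nlinarith [Nat.le_self_pow (n := 3) (by norm_num) (b + 1)]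
    have := Nat.le_findGreatest (P := fun b => 133 * b ^ 3 ≤ n) hle h
    omega
  have hn' : n ≤ 1064 * b ^ 3 := by
    have : (b + 1) ^ 3 ≤ (2 * b) ^ 3 := Nat.pow_le_pow_left (by omega) 3
    rw [mul_pow] at this
    omega
  obtain ⟨X, hX, hth⟩ := CopsRobbers.exists_connected_sq_le_dmgThrottling hb₁ hbn
  refine ⟨X, hX, le_trans ?_ (Nat.cast_le.2 hth)⟩
  have hb₀ : (0 : ℝ) ≤ b := Nat.cast_nonneg b
  have hpow : ((b : ℝ) ^ 3) ^ ((2 : ℝ) / 3) = (b : ℝ) ^ 2 := by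
    rw [← Real.rpow_natCast, ← Real.rpow_mul hb₀, ← Real.rpow_natCast]
    norm_num
  have hconst : (1064 : ℝ) ^ ((2 : ℝ) / 3) ≤ 1064 := by
    simpa using Real.rpow_le_rpow_of_exponent_le (x := 1064) (by norm_num)
      (show (2 : ℝ) / 3 ≤ 1 by norm_num)
  have hmain : (n : ℝ) ^ ((2 : ℝ) / 3) ≤ 1064 * (b : ℝ) ^ 2 := by
    calc (n : ℝ) ^ ((2 : ℝ) / 3) ≤ (1064 * (b : ℝ) ^ 3) ^ ((2 : ℝ) / 3) :=
          Real.rpow_le_rpow (Nat.cast_nonneg n) (by exact_mod_cast hn') (by norm_num)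
      _ = 1064 ^ ((2 : ℝ) / 3) * (b : ℝ) ^ 2 := by
          rw [Real.mul_rpow (by norm_num) (by positivity), hpow]
      _ ≤ 1064 * (b : ℝ) ^ 2 := by gcongr
  push_cast
  linarith
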